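/- Let $\xi,\eta$ be real random variables on a common probability space with $\xi>0$ and $\eta>0$ almost surely. Put $$D_\eta=\{y>0:\ \mathrm P(\eta\in(y-\delta,y+\delta))>0\ \text{for each}\ \delta>0\},\qquad \mathrm P(\xi>x\mid\eta=y)=\lim_{t\downarrow0}\frac{\mathrm P(\xi>x,\ \eta\in[y,y+t))}{\mathrm P(\eta\in[y,y+t))}.$$ Assume that $(\xi,\eta)$ is conditionally dependent with a continuous function $s_0:(0,\infty)\to(0,\infty)$, that is, the above quotients are defined and the limit exists for all $x\in\mathbb R$ and $y\in D_\eta$, and $$\lim_{x\to\infty}\ \sup_{y\in D_\eta}\left|\frac{\mathrm P(\xi>x\mid\eta=y)}{\mathrm P(\xi>x)\,s_0(y)}-1\right|=0 .$$ Assume also that the distribution of $\xi$ is long-tailed: $\mathrm P(\xi>x-t)/\mathrm P(\xi>x)\to1$ as $x\to\infty$ for each $t>0$. Let $X=\xi-\eta$ and $Y=\eta$, write $\overline F(x)=\mathrm P(X>x)$ and $\overline G(x)=\mathrm P(Y>x)$, and let $s(y)=s_0(y)/\mathrm E s_0(\eta)$ for $y>0$. Let $\alpha\ge0$ and assume that $\overline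 F(xy)/\overline F(x)\to y^{-\alpha}$ as $x\to\infty$ for each $y>0$, that $\overline G(x)=o(\overline F(x))$ as $x\to\infty$, and that at least one of the following holds: (i) $\mathrm E\,[Y^{\alpha+\varepsilon}s(Y)]<\infty$ for some $\varepsilon>0$; (ii) $\mathrm E\,[Y^{\alpha}s(Y)]<\infty$, and there are a positive function $L$ on $(0,\infty)$ that is slowly varying at infinity (that is, $L(xy)/L(x)\to1$ as $x\to\infty$ for each $y>0$) with $\overline F(x)\sim x^{-\alpha}L(x)$ as $x\to\infty$, and a positive function $g$ on $[0,\infty)$ such that $g(x)$ is non-increasing with limit $0$, $xg(x)$ is non-decreasing with limit $\infty$, $\overline G(xg(x))=o(\overline F(x))$ as $x\to\infty$, and $$\limsup_{x\to\infty}\ \sup_{1\le y\le xg(x)}\frac{L(x/y)}{L(x)}<\infty .$$ Then $0<\mathrm E s_0(\eta)<\infty$, $\mathrm E\,[Y^\alpha s(Y)]<\infty$, and $$\mathrm P(XY>x)\sim \mathrm E\,[Y^\alpha s(Y)]\;\overline F(x)\qquad\text{as }x\to\infty .$$ -/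

import Mathlib

open Set Filter Topology MeasureTheory ProbabilityTheory
open scoped Asymptotics

noncomputable section

/-- The tail `P(X > x)` of the distribution of `X`. -/
def tail {Ω : Type*} [MeasurableSpace Ω] (μ : Measure Ω) (X : Ω → ℝ) (x : ℝ) : ℝ :=
  μ.real {ω | x < X ω}

/-- The set `D_Y` of all `y > 0` each of whose neighbourhoods is charged by the law of `Y`. -/
def posSupport {Ω : Type*} [MeasurableSpace Ω] (μ : Measure Ω) (Y : Ω → ℝ) : Set ℝ :=
  {y | 0 < y ∧ ∀ δ : ℝ, 0 < δ → 0 < μ {ω | Y ω ∈ Ioo (y - δ) (y + δ)}}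

/-- The conditional probability `P(X > x | Y = y)`, the limit as `t ↓ 0` of
`P(X > x, Y ∈ [y, y + t)) / P(Y ∈ [y, y + t))`, exists and is equal to `p`.
The first conjunct says that the quotients are defined (no division by zero). -/
def HasCondTail {Ω : Type*} [MeasurableSpace Ω] (μ : Measure Ω) (X Y : Ω → ℝ)
    (x y p : ℝ) : Prop :=
  (∀ t : ℝ, 0 < t → 0 < μ {ω | Y ω ∈ Ico y (y + t)}) ∧
    Tendsto (fun t : ℝ => μ.real {ω | x < X ω ∧ Y ω ∈ Ico y (y + t)} /
      μ.real {ω | Y ω ∈ Ico y (y + t)}) (𝓝[>] 0) (𝓝 p)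

/-- `(X, Y)` is conditionally dependent with the function `s` : `s` is positive and measurable on
`(0, ∞)`, the conditional probabilities `P(X > x | Y = y)` exist for all real `x` and `y ∈ D_Y`,
and `P(X > x | Y = y) / (P(X > x) s(y)) → 1` as `x → ∞`, uniformly in `y ∈ D_Y`. -/
def IsCDWith {Ω : Type*} [MeasurableSpace Ω] (μ : Measure Ω) (X Y : Ω → ℝ)
    (s : ℝ → ℝ) : Prop :=
  (∀ y : ℝ, 0 < y → 0 < s y) ∧ Measurable ((Ioi (0 : ℝ)).domRestrict s) ∧
    ∃ p : ℝ → ℝ → ℝ,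
      (∀ x : ℝ, ∀ y ∈ posSupport μ Y, HasCondTail μ X Y x y (p x y)) ∧
      TendstoUniformlyOn (fun x y => p x y / (tail μ X x * s y)) (fun _ => 1) atTop
        (posSupport μ Y)

/-- A distribution with tail `T` is long-tailed : `T(x - t) ∼ T(x)` for each `t > 0`. -/
def IsLongTailed (T : ℝ → ℝ) : Prop :=
  ∀ t : ℝ, 0 < t → Tendsto (fun x => T (x - t) / T x) atTop (𝓝 1)

/-- A distribution with tail `T` is regularly-varying-tailed with index `α` :
`T(x y) / T(x) → y ^ (-α)` for each `y > 0`. -/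
def IsRegVaryingTail (T : ℝ → ℝ) (α : ℝ) : Prop :=
  ∀ y : ℝ, 0 < y → Tendsto (fun x => T (x * y) / T x) atTop (𝓝 (y ^ (-α)))

/-- `L` is a positive function on `(0, ∞)`, slowly varying at infinity. -/
def IsSlowlyVarying (L : ℝ → ℝ) : Prop :=
  (∀ x : ℝ, 0 < x → 0 < L x) ∧
    ∀ y : ℝ, 0 < y → Tendsto (fun x => L (x * y) / L x) atTop (𝓝 1)

/-- `g` is a positive function on `[0, ∞)` with `g(x) ↓ 0`, `x g(x) ↑ ∞` and
`Gbar(x g(x)) = o(Fbar(x))`. -/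
def IsCutoff (Gbar Fbar g : ℝ → ℝ) : Prop :=
  (∀ x : ℝ, 0 ≤ x → 0 < g x) ∧
    AntitoneOn g (Ici 0) ∧ Tendsto g atTop (𝓝 0) ∧
    MonotoneOn (fun x => x * g x) (Ici 0) ∧ Tendsto (fun x => x * g x) atTop atTop ∧
    (fun x => Gbar (x * g x)) =o[atTop] Fbar

/-- `limsup_{x → ∞} sup_{1 ≤ y ≤ x g(x)} L(x / y) / L(x) < ∞`. -/
def CutoffBound (L g : ℝ → ℝ) : Prop :=
  limsup (fun x : ℝ => ⨆ y ∈ Icc (1 : ℝ) (x * g x), ((L (x / y) / L x : ℝ) : EReal)) atTop < ⊤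

end

/-! Write `T` for the tail of `ξ`. The one-sided limits defining `P(ξ > x | η = y)` are tied to the
regular conditional distribution `condDistrib ξ η μ`, after which everything is dominated
convergence over the law of `η`.

The kernel value on `(x, ∞)` is the Radon-Nikodym derivative of the law of `η` on `{ξ > x}` with
respect to the law of `η`. Since `s₀` is continuous, bounds on one-sided quotients hold near each
point with a common constant. They pass to centred balls, hence to this derivative by Besicovitch
differentiation. So, almost everywhere, the kernel tail lies between `(1 ± ε) T(z) s₀(y)` for all
large `z` (`IsCDWith.eventually_condDistrib_Ioi_mem_Icc`).

Hence `s₀(η)` is almost surely bounded. Integrating the kernel tails gives `E s₀(η) = 1`, so `s =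
s₀`. Long-tailedness then gives `P(ξ - η > x) ∼ T(x)`, and `T` inherits regular variation. For `η >
0`, `(ξ - η) η > x` means `ξ > η + x / η`, and `T(y + x / y) / T(x) → y ^ α`. Values `η > b(x)` have
probability `o(T(x))`; for `y ≤ b(x)` the ratio has an integrable majorant, obtained from a Potter
bound in case (i) and from the cutoff condition in case (ii). -/

/-! ### From one-sided difference quotients to Radon-Nikodym derivatives. -/

section OneSided

/-- Real induction on the right endpoint: the admissible endpoints are closed under increasing
limits by continuity from below, and any of them below `b` can be moved to the right by additivity.
-/
theorem measure_Ico_le_of_eventually_le {ρ₁ ρ₂ : Measure ℝ} {a b : ℝ} (hab : a ≤ b)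
    (h : ∀ y ∈ Ico a b, ∀ᶠ t in 𝓝[>] (0 : ℝ), ρ₁ (Ico y (y + t)) ≤ ρ₂ (Ico y (y + t))) :
    ρ₁ (Ico a b) ≤ ρ₂ (Ico a b) := by
  set S : Set ℝ := {c | c ∈ Icc a b ∧ ρ₁ (Ico a c) ≤ ρ₂ (Ico a c)} with hS
  have haS : a ∈ S := ⟨⟨le_rfl, hab⟩, by simp⟩
  have hbdd : BddAbove S := ⟨b, fun c hc => hc.1.2⟩
  have hlub : IsLUB S (sSup S) := isLUB_csSup ⟨a, haS⟩ hbdd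
  obtain ⟨u, hu_mono, -, hu_lim, hu_mem⟩ := hlub.exists_seq_monotone_tendsto ⟨a, haS⟩
  have hle : ∀ n, u n ≤ sSup S := fun n => hlub.1 (hu_mem n)
  have hUnion : ⋃ n, Ico a (u n) = Ico a (sSup S) := by
    ext z
    simp only [mem_iUnion, mem_Ico]
    constructor
    · rintro ⟨n, h1, h2⟩
      exact ⟨h1, h2.trans_le (hle n)⟩
    · rintro ⟨h1, h2⟩
      obtain ⟨n, hn⟩ := (hu_lim.eventually_const_lt h2).exists
      exact ⟨n, h1, hn⟩
  have hm : Monotone fun n => Ico a (u n) := fun m n hmn => Ico_subset_Ico_right (hu_mono hmn)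
  have hsup : sSup S ∈ S := by
    refine ⟨⟨hlub.1 haS, hlub.2 fun c hc => hc.1.2⟩, ?_⟩
    have h1 := tendsto_measure_iUnion_atTop (μ := ρ₁) hm
    have h2 := tendsto_measure_iUnion_atTop (μ := ρ₂) hm
    rw [hUnion] at h1 h2
    exact le_of_tendsto_of_tendsto' h1 h2 fun n => (hu_mem n).2
  rcases hsup.1.2.eq_or_lt with heq | hlt
  · rw [← heq]
    exact hsup.2
  · have hmem : ∀ᶠ t in 𝓝[>] (0 : ℝ), t ∈ Ioo 0 (b - sSup S) :=
      Ioo_mem_nhdsGT (sub_pos.2 hlt)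
    obtain ⟨t, ht, ht0, htb⟩ := ((h _ ⟨hsup.1.1, hlt⟩).and hmem).exists
    have hsplit : Ico a (sSup S + t) = Ico a (sSup S) ∪ Ico (sSup S) (sSup S + t) :=
      (Ico_union_Ico_eq_Ico hsup.1.1 (by linarith)).symm
    have hdisj : Disjoint (Ico a (sSup S)) (Ico (sSup S) (sSup S + t)) := by
      rw [Set.disjoint_left]
      intro z hz hz'
      exact absurd hz.2 (not_lt.2 hz'.1)
    have hnew : sSup S + t ∈ S := by
      refine ⟨⟨by linarith [hsup.1.1], by linarith⟩, ?_⟩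
      rw [hsplit, measure_union hdisj measurableSet_Ico, measure_union hdisj measurableSet_Ico]
      exact add_le_add hsup.2 ht
    exact absurd (hlub.1 hnew) (by linarith)

/-- A closed ball is a decreasing intersection of half-open intervals, so finiteness of the measures
gives continuity from above. -/
theorem measure_closedBall_le_of_eventually_le {ρ₁ ρ₂ : Measure ℝ} [IsFiniteMeasure ρ₁]
    [IsFiniteMeasure ρ₂] {y₀ r₀ : ℝ}
    (h : ∀ y ∈ Ioo (y₀ - r₀) (y₀ + r₀), ∀ᶠ t in 𝓝[>] (0 : ℝ),
      ρ₁ (Ico y (y + t)) ≤ ρ₂ (Ico y (y + t)))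
    {r : ℝ} (hr : r ∈ Ioo 0 r₀) : ρ₁ (Metric.closedBall y₀ r) ≤ ρ₂ (Metric.closedBall y₀ r) := by
  obtain ⟨u, hu_anti, hu_mem, hu_lim⟩ := exists_seq_strictAnti_tendsto' hr.2
  have hInter : ⋂ n, Ico (y₀ - r) (y₀ + u n) = Metric.closedBall y₀ r := by
    rw [Real.closedBall_eq_Icc]
    ext z
    simp only [mem_iInter, mem_Ico, mem_Icc]
    constructor
    · intro hz
      have := ge_of_tendsto' hu_lim (b := z - y₀) fun n => by linarith [(hz n).2]
      exact ⟨(hz 0).1, by linarith⟩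
    · rintro ⟨h1, h2⟩ n
      exact ⟨h1, by linarith [(hu_mem n).1]⟩
  have hm : Antitone fun n => Ico (y₀ - r) (y₀ + u n) := fun m n hmn =>
    Ico_subset_Ico_right (by linarith [hu_anti.antitone hmn])
  have h1 := tendsto_measure_iInter_atTop (μ := ρ₁)
    (fun n => measurableSet_Ico.nullMeasurableSet) hm ⟨0, measure_ne_top _ _⟩
  have h2 := tendsto_measure_iInter_atTop (μ := ρ₂)
    (fun n => measurableSet_Ico.nullMeasurableSet) hm ⟨0, measure_ne_top _ _⟩
  rw [hInter] at h1 h2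
  refine le_of_tendsto_of_tendsto' h1 h2 fun n => ?_
  refine measure_Ico_le_of_eventually_le (by linarith [hr.1, (hu_mem n).1]) fun y hy => h y ⟨?_, ?_⟩
  · linarith [hy.1, hr.2]
  · linarith [hy.2, (hu_mem n).2]

/-- One-sided upper derivative bounds pass to the Radon-Nikodym derivative. -/
theorem ae_rnDeriv_le_of_eventually_le {ρ ν : Measure ℝ} [IsFiniteMeasure ρ] [IsFiniteMeasure ν]
    {u : ℝ → ℝ} (hu : ContinuousOn u (Ioi 0))
    (h : ∀ y, 0 < y → ∀ C, u y < C → ∀ᶠ t in 𝓝[>] (0 : ℝ),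
      ρ (Ico y (y + t)) ≤ ENNReal.ofReal C * ν (Ico y (y + t))) :
    ∀ᵐ y ∂ν, 0 < y → ρ.rnDeriv ν y ≤ ENNReal.ofReal (u y) := by
  filter_upwards [Besicovitch.ae_tendsto_rnDeriv ρ ν] with y hy hy0
  have key : ∀ C, u y < C → ρ.rnDeriv ν y ≤ ENNReal.ofReal C := by
    intro C hC
    -- Continuity of `u` makes one constant `C` serve on a whole neighbourhood, as the comparison on
    -- balls requires.
    have hnear : ∀ᶠ z in 𝓝 y, 0 < z ∧ u z < C :=
      (lt_mem_nhds hy0).and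
        ((hu.continuousAt (Ioi_mem_nhds hy0)).eventually (gt_mem_nhds hC))
    obtain ⟨r₀, hr₀, hball⟩ := Metric.eventually_nhds_iff_ball.1 hnear
    have hfin : IsFiniteMeasure (ENNReal.ofReal C • ν) := Measure.smul_finite _ ENNReal.ofReal_ne_top
    refine le_of_tendsto hy ?_
    filter_upwards [Ioo_mem_nhdsGT hr₀] with r hr
    refine ENNReal.div_le_of_le_mul ?_
    refine measure_closedBall_le_of_eventually_le (ρ₂ := ENNReal.ofReal C • ν) (fun z hz => ?_) hr
    have hz' := hball z (by rwa [Real.ball_eq_Ioo])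
    exact h z hz'.1 C hz'.2
  have hlim : Tendsto (fun C => ENNReal.ofReal C) (𝓝[>] (u y)) (𝓝 (ENNReal.ofReal (u y))) :=
    (ENNReal.continuous_ofReal.tendsto _).mono_left nhdsWithin_le_nhds
  exact ge_of_tendsto hlim (eventually_mem_nhdsWithin.mono fun C hC => key C hC)

/-- One-sided lower derivative bounds pass to the Radon-Nikodym derivative. -/
theorem ae_le_rnDeriv_of_eventually_le {ρ ν : Measure ℝ} [IsFiniteMeasure ρ] [IsFiniteMeasure ν]
    {u : ℝ → ℝ} (hu : ContinuousOn u (Ioi 0))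
    (h : ∀ y, 0 < y → ∀ C, C < u y → ∀ᶠ t in 𝓝[>] (0 : ℝ),
      ENNReal.ofReal C * ν (Ico y (y + t)) ≤ ρ (Ico y (y + t))) :
    ∀ᵐ y ∂ν, 0 < y → ENNReal.ofReal (u y) ≤ ρ.rnDeriv ν y := by
  filter_upwards [Besicovitch.ae_tendsto_rnDeriv ρ ν, Measure.support_mem_ae (μ := ν)]
    with y hy hsupp hy0
  have key : ∀ C, C < u y → ENNReal.ofReal C ≤ ρ.rnDeriv ν y := by
    intro C hC
    have hnear : ∀ᶠ z in 𝓝 y, 0 < z ∧ C < u z :=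
      (lt_mem_nhds hy0).and
        ((hu.continuousAt (Ioi_mem_nhds hy0)).eventually (lt_mem_nhds hC))
    obtain ⟨r₀, hr₀, hball⟩ := Metric.eventually_nhds_iff_ball.1 hnear
    have hfin : IsFiniteMeasure (ENNReal.ofReal C • ν) := Measure.smul_finite _ ENNReal.ofReal_ne_top
    refine ge_of_tendsto hy ?_
    filter_upwards [Ioo_mem_nhdsGT hr₀] with r hr
    -- Unlike the upper bound, the lower bound fails for the convention `0 / 0 = 0`, so `y` must lie
    -- in the support of `ν`.
    have hpos : 0 < ν (Metric.closedBall y r) :=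
      (Measure.mem_support_iff_forall y).1 hsupp _ (Metric.closedBall_mem_nhds y hr.1)
    rw [ENNReal.le_div_iff_mul_le (Or.inl hpos.ne') (Or.inl (measure_ne_top _ _))]
    refine measure_closedBall_le_of_eventually_le (ρ₁ := ENNReal.ofReal C • ν) (fun z hz => ?_) hr
    have hz' := hball z (by rwa [Real.ball_eq_Ioo])
    exact h z hz'.1 C hz'.2
  have hlim : Tendsto (fun C => ENNReal.ofReal C) (𝓝[<] (u y)) (𝓝 (ENNReal.ofReal (u y))) :=
    (ENNReal.continuous_ofReal.tendsto _).mono_left nhdsWithin_le_nhds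
  exact le_of_tendsto hlim (eventually_mem_nhdsWithin.mono fun C hC => key C hC)

end OneSided

/-! ### Tails of the regular conditional distribution. -/

section Conditional

variable {Ω : Type*} [MeasurableSpace Ω] {μ : Measure Ω} {ξ η : Ω → ℝ}

theorem tail_antitone [IsFiniteMeasure μ] (X : Ω → ℝ) : Antitone (tail μ X) := fun _ _ hxy =>
  measureReal_mono fun _ hω => lt_of_le_of_lt hxy hω

theorem tail_nonneg (X : Ω → ℝ) (x : ℝ) : 0 ≤ tail μ X x := measureReal_nonneg

theorem tail_eq_map_Ioi (hξ : Measurable ξ) (x : ℝ) : tail μ ξ x = (μ.map ξ).real (Ioi x) := by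
  rw [map_measureReal_apply hξ measurableSet_Ioi]
  rfl

theorem tendsto_measureReal_Ioi {m : Measure ℝ} [IsFiniteMeasure m] {z : ℝ} {q : ℕ → ℝ}
    (hq : StrictAnti q) (hlim : Tendsto q atTop (𝓝 z)) :
    Tendsto (fun n => m.real (Ioi (q n))) atTop (𝓝 (m.real (Ioi z))) := by
  have hUnion : ⋃ n, Ioi (q n) = Ioi z := by
    ext w
    simp only [mem_iUnion, mem_Ioi]
    constructor
    · rintro ⟨n, hn⟩
      exact (hq.antitone.le_of_tendsto hlim n).trans_lt hn
    · intro hw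
      exact (hlim.eventually_lt_const hw).exists
  have h := tendsto_measure_iUnion_atTop (μ := m) (s := fun n => Ioi (q n))
    fun i j hij => Ioi_subset_Ioi (hq.antitone hij)
  rw [hUnion] at h
  exact (ENNReal.tendsto_toReal (measure_ne_top _ _)).comp h

/-- Identifies the kernel tail as the density to which the differentiation results apply. -/
theorem map_restrict_eq_withDensity_condDistrib [IsFiniteMeasure μ]
    (hξ : Measurable ξ) (hη : Measurable η) (x : ℝ) :
    (μ.restrict {ω | x < ξ ω}).map η =
      (μ.map η).withDensity fun y => condDistrib ξ η μ y (Ioi x) := by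
  ext B hB
  rw [withDensity_apply _ hB, setLIntegral_map hB (Kernel.measurable_coe _ measurableSet_Ioi) hη,
    setLIntegral_preimage_condDistrib hη hξ.aemeasurable measurableSet_Ioi hB,
    Measure.map_apply hη hB, Measure.restrict_apply (hη hB)]
  rfl

theorem eventually_measure_Ico_eq_zero {y : ℝ} (hy : 0 < y) (hD : y ∉ posSupport μ η) :
    ∀ᶠ t in 𝓝[>] (0 : ℝ), μ {ω | η ω ∈ Ico y (y + t)} = 0 := by
  simp only [posSupport, mem_ofPred_eq, not_and, not_forall, not_lt, nonpos_iff_eq_zero] at hD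
  obtain ⟨δ, hδ, h0⟩ := hD hy
  filter_upwards [Ioo_mem_nhdsGT hδ] with t ht
  refine measure_mono_null (fun ω hω => ?_) h0
  exact ⟨by linarith [hω.1], by linarith [hω.2, ht.2]⟩

variable [IsProbabilityMeasure μ]

/-- If the conditional probabilities `P(ξ > x | η = y)` are relatively `ε`-close to `T s(y)`,
so are the values of the regular conditional distribution. -/
theorem ae_condDistrib_Ioi_mem_Icc (hξ : Measurable ξ) (hη : Measurable η)
    (hηpos : ∀ᵐ ω ∂μ, 0 < η ω) {s : ℝ → ℝ} (hs : ContinuousOn s (Ioi 0))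
    (hspos : ∀ y, 0 < y → 0 < s y) {T ε x : ℝ} (hT : 0 < T) (hε0 : 0 ≤ ε) {p : ℝ → ℝ}
    (hp : ∀ y ∈ posSupport μ η, HasCondTail μ ξ η x y (p y))
    (hε : ∀ y ∈ posSupport μ η, |p y / (T * s y) - 1| ≤ ε) :
    ∀ᵐ y ∂(μ.map η), (condDistrib ξ η μ y).real (Ioi x) ∈
      Icc ((1 - ε) * (T * s y)) ((1 + ε) * (T * s y)) := by
  have := Measure.isProbabilityMeasure_map hη.aemeasurable (μ := μ)
  set ρ := (μ.restrict {ω | x < ξ ω}).map η with hρ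
  set ν := μ.map η with hν
  have hρI : ∀ y t, ρ (Ico y (y + t)) = μ {ω | x < ξ ω ∧ η ω ∈ Ico y (y + t)} := by
    intro y t
    rw [hρ, Measure.map_apply hη measurableSet_Ico, Measure.restrict_apply (hη measurableSet_Ico)]
    congr 1
    ext ω
    exact and_comm
  have hνI : ∀ y t, ν (Ico y (y + t)) = μ {ω | η ω ∈ Ico y (y + t)} := fun y t =>
    Measure.map_apply hη measurableSet_Ico
  -- Off `posSupport μ η` the quotients carry no information, but both measures vanish on short
  -- intervals, so both comparisons are trivial.
  have hzero : ∀ y, 0 < y → y ∉ posSupport μ η → ∀ᶠ t in 𝓝[>] (0 : ℝ),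
      ρ (Ico y (y + t)) = 0 ∧ ν (Ico y (y + t)) = 0 := by
    intro y hy hD
    filter_upwards [eventually_measure_Ico_eq_zero hy hD] with t ht
    rw [hρI, hνI]
    exact ⟨measure_mono_null (fun ω hω => hω.2) ht, ht⟩
  have hbounds : ∀ y ∈ posSupport μ η,
      (1 - ε) * (T * s y) ≤ p y ∧ p y ≤ (1 + ε) * (T * s y) := by
    intro y hy
    have hpos : 0 < T * s y := mul_pos hT (hspos y hy.1)
    have h := abs_le.1 (hε y hy)
    have h1 : 1 - ε ≤ p y / (T * s y) := by linarith [h.1]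
    have h2 : p y / (T * s y) ≤ 1 + ε := by linarith [h.2]
    exact ⟨(le_div_iff₀ hpos).1 h1, (div_le_iff₀ hpos).1 h2⟩
  have hcont : ∀ c : ℝ, ContinuousOn (fun y => c * (T * s y)) (Ioi 0) := fun c =>
    continuousOn_const.mul (continuousOn_const.mul hs)
  have hupper := ae_rnDeriv_le_of_eventually_le (ρ := ρ) (ν := ν) (hcont (1 + ε)) (by
    intro y hy C hC
    by_cases hD : y ∈ posSupport μ η
    · filter_upwards [(hp y hD).2.eventually (gt_mem_nhds ((hbounds y hD).2.trans_lt hC)),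
        self_mem_nhdsWithin] with t ht ht0
      have hpos : 0 < μ.real {ω | η ω ∈ Ico y (y + t)} :=
        ENNReal.toReal_pos ((hp y hD).1 t ht0).ne' (measure_ne_top _ _)
      rw [hρI, hνI, ← ofReal_measureReal, ← ofReal_measureReal,
        ← ENNReal.ofReal_mul' measureReal_nonneg]
      exact ENNReal.ofReal_le_ofReal ((div_lt_iff₀ hpos).1 ht).le
    · filter_upwards [hzero y hy hD] with t ht
      rw [ht.1]
      exact zero_le)
  have hlower := ae_le_rnDeriv_of_eventually_le (ρ := ρ) (ν := ν) (hcont (1 - ε)) (by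
    intro y hy C hC
    by_cases hD : y ∈ posSupport μ η
    · filter_upwards [(hp y hD).2.eventually (lt_mem_nhds (hC.trans_le (hbounds y hD).1)),
        self_mem_nhdsWithin] with t ht ht0
      have hpos : 0 < μ.real {ω | η ω ∈ Ico y (y + t)} :=
        ENNReal.toReal_pos ((hp y hD).1 t ht0).ne' (measure_ne_top _ _)
      rw [hρI, hνI, ← ofReal_measureReal, ← ofReal_measureReal,
        ← ENNReal.ofReal_mul' measureReal_nonneg]
      exact ENNReal.ofReal_le_ofReal ((lt_div_iff₀ hpos).1 ht).le
    · filter_upwards [hzero y hy hD] with t ht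
      rw [ht.2, mul_zero]
      exact zero_le)
  have hrn : ρ.rnDeriv ν =ᵐ[ν] fun y => condDistrib ξ η μ y (Ioi x) := by
    rw [hρ, map_restrict_eq_withDensity_condDistrib hξ hη x]
    exact Measure.rnDeriv_withDensity _ (Kernel.measurable_coe _ measurableSet_Ioi)
  have hpos : ∀ᵐ y ∂ν, 0 < y := (ae_map_iff hη.aemeasurable measurableSet_Ioi).2 hηpos
  filter_upwards [hupper, hlower, hrn, hpos] with y h1 h2 h3 h4
  rw [h3] at h1 h2
  have hne : condDistrib ξ η μ y (Ioi x) ≠ ⊤ := measure_ne_top _ _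
  refine ⟨(ENNReal.ofReal_le_iff_le_toReal hne).1 (h2 h4), ?_⟩
  exact ENNReal.toReal_le_of_le_ofReal (mul_nonneg (by linarith) (mul_pos hT (hspos y h4)).le) (h1 h4)

/-- The uniform asymptotics of the conditional tails of the regular conditional distribution. -/
theorem IsCDWith.eventually_condDistrib_Ioi_mem_Icc {s : ℝ → ℝ} (hCD : IsCDWith μ ξ η s)
    (hξ : Measurable ξ) (hη : Measurable η)
    (hηpos : ∀ᵐ ω ∂μ, 0 < η ω) (hs : ContinuousOn s (Ioi 0))
    (hT : ∀ x, 0 < tail μ ξ x) {ε : ℝ} (hε : 0 < ε) :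
    ∃ x₀, ∀ᵐ y ∂(μ.map η), 0 < y ∧ ∀ z, x₀ ≤ z → (condDistrib ξ η μ y).real (Ioi z) ∈
      Icc ((1 - ε) * (tail μ ξ z * s y)) ((1 + ε) * (tail μ ξ z * s y)) := by
  obtain ⟨hspos, -, p, hp, hunif⟩ := hCD
  obtain ⟨x₀, hx₀⟩ := eventually_atTop.1 (Metric.tendstoUniformlyOn_iff.1 hunif ε hε)
  refine ⟨x₀, ?_⟩
  -- The exceptional null set depends on the level; rational levels give a single null set, and
  -- right continuity of tails then reaches every real level.
  have hrat : ∀ᵐ y ∂(μ.map η), ∀ q : ℚ, x₀ ≤ q → (condDistrib ξ η μ y).real (Ioi (q : ℝ)) ∈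
      Icc ((1 - ε) * (tail μ ξ q * s y)) ((1 + ε) * (tail μ ξ q * s y)) := by
    rw [ae_all_iff]
    intro q
    by_cases hq : x₀ ≤ q
    · filter_upwards [ae_condDistrib_Ioi_mem_Icc hξ hη hηpos hs hspos (hT q) hε.le (hp q) (fun y hy => by
        have := (hx₀ q hq y hy).le
        rwa [dist_comm, Real.dist_eq] at this)] with y hy _
      exact hy
    · exact Eventually.of_forall fun y h => absurd h hq
  have hpos : ∀ᵐ y ∂(μ.map η), 0 < y := (ae_map_iff hη.aemeasurable measurableSet_Ioi).2 hηpos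
  filter_upwards [hrat, hpos] with y hy hy0
  refine ⟨hy0, fun z hz => ?_⟩
  obtain ⟨q, hq_anti, hq_gt, hq_lim⟩ := Real.exists_seq_rat_strictAnti_tendsto z
  have hanti : StrictAnti fun n => (q n : ℝ) := fun m n hmn => Rat.cast_lt.2 (hq_anti hmn)
  have h1 := tendsto_measureReal_Ioi (m := condDistrib ξ η μ y) hanti hq_lim
  have hprob := Measure.isProbabilityMeasure_map hξ.aemeasurable (μ := μ)
  have h2 := tendsto_measureReal_Ioi (m := μ.map ξ) hanti hq_lim
  simp only [← tail_eq_map_Ioi hξ] at h2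
  have hmem : ∀ n, (condDistrib ξ η μ y).real (Ioi (q n : ℝ)) ∈
      Icc ((1 - ε) * (tail μ ξ (q n) * s y)) ((1 + ε) * (tail μ ξ (q n) * s y)) := fun n =>
    hy (q n) (hz.trans (hq_gt n).le)
  exact ⟨le_of_tendsto_of_tendsto' ((h2.mul_const _).const_mul _) h1 fun n => (hmem n).1,
    le_of_tendsto_of_tendsto' h1 ((h2.mul_const _).const_mul _) fun n => (hmem n).2⟩

end Conditional

/-! ### Long-tailed and regularly varying tails, and bounds for `T(x / y) / T(x)`. -/

section TailAsymptotics

theorem IsLongTailed.pos {T : ℝ → ℝ} (h : IsLongTailed T) (hanti : Antitone T)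
    (h0 : ∀ x, 0 ≤ T x) (x : ℝ) : 0 < T x := by
  -- Division by zero yields `0`, so a ratio near `1` forces a nonzero denominator; monotonicity
  -- carries positivity back to every point.
  have hne : ∀ᶠ z in atTop, T z ≠ 0 := by
    filter_upwards [(h 1 one_pos).eventually (lt_mem_nhds (show (0 : ℝ) < 1 by norm_num))]
      with z hz hz0
    simp [hz0] at hz
  obtain ⟨z, hz, hxz⟩ := (hne.and (eventually_ge_atTop x)).exists
  exact ((h0 z).lt_of_ne' hz).trans_le (hanti hxz)

theorem IsLongTailed.tendsto_add {T : ℝ → ℝ} (h : IsLongTailed T) {t : ℝ} (ht : 0 < t) :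
    Tendsto (fun x => T (x + t) / T x) atTop (𝓝 1) := by
  have h1 := ((h t ht).comp (tendsto_atTop_add_const_right atTop t tendsto_id)).inv₀ one_ne_zero
  simpa using h1

theorem IsRegVaryingTail.tendsto_div {T : ℝ → ℝ} {α : ℝ} (h : IsRegVaryingTail T α) {y : ℝ}
    (hy : 0 < y) : Tendsto (fun x => T (x / y) / T x) atTop (𝓝 (y ^ α)) := by
  have := h y⁻¹ (inv_pos.2 hy)
  rwa [Real.inv_rpow hy.le, Real.rpow_neg hy.le, inv_inv] at this

theorem IsRegVaryingTail.of_tendsto_div {F T : ℝ → ℝ} {α : ℝ} (hF : IsRegVaryingTail F α)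
    (hT : ∀ x, 0 < T x) (hFT : Tendsto (fun x => F x / T x) atTop (𝓝 1)) :
    IsRegVaryingTail T α := by
  intro y hy
  have h1 := (hFT.comp (tendsto_id.atTop_mul_const hy)).inv₀ one_ne_zero
  have h2 := (h1.mul (hF y hy)).mul hFT
  simp only [inv_one, one_mul, mul_one] at h2
  refine h2.congr' ?_
  have hne : ∀ᶠ x in atTop, F x ≠ 0 := by
    filter_upwards [hFT.eventually (lt_mem_nhds (show (0 : ℝ) < 1 by norm_num))] with z hz hz0
    simp [hz0] at hz
  filter_upwards [hne, (tendsto_id.atTop_mul_const hy).eventually hne] with x hx hxy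
  simp only [id] at hxy
  have := (hT x).ne'
  have := (hT (x * y)).ne'
  simp only [Function.comp, id]
  field_simp

/-- A one-sided Potter bound for monotone regularly varying tails. -/
theorem IsRegVaryingTail.potter_bound {T : ℝ → ℝ} {α β : ℝ} (h : IsRegVaryingTail T α)
    (hanti : Antitone T) (hT : ∀ x, 0 < T x) (hβ : 0 ≤ β) (hαβ : α < β) :
    ∃ x₁ : ℝ, 0 < x₁ ∧ ∀ x y, 1 ≤ y → x₁ ≤ x / y → T (x / y) ≤ (2 * y) ^ β * T x := by
  -- One halving costs at most `2 ^ β`, because the limiting ratio is `2 ^ α < 2 ^ β`; iterating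
  -- over dyadic scales gives the bound.
  have hlim := (h.tendsto_div two_pos).eventually
    (gt_mem_nhds (Real.rpow_lt_rpow_of_exponent_lt one_lt_two hαβ))
  obtain ⟨x₁, hx₁⟩ := eventually_atTop.1 hlim
  have hstep : ∀ x, max x₁ 1 ≤ x → T (x / 2) ≤ 2 ^ β * T x := fun x hx =>
    ((div_lt_iff₀ (hT x)).1 (hx₁ x ((le_max_left _ _).trans hx))).le
  have hiter : ∀ n : ℕ, ∀ x, max x₁ 1 ≤ x / 2 ^ n →
      T (x / 2 ^ (n + 1)) ≤ ((2 : ℝ) ^ β) ^ (n + 1) * T x := by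
    intro n
    induction n with
    | zero => intro x hx; simpa using hstep x (by simpa using hx)
    | succ n ih =>
      intro x hx
      have h0 : 0 ≤ x / 2 ^ (n + 1) :=
        (zero_le_one.trans (le_max_right x₁ 1)).trans hx
      have h1 : max x₁ 1 ≤ x / 2 ^ n := by
        have : x / 2 ^ n = 2 * (x / 2 ^ (n + 1)) := by rw [pow_succ]; field_simp
        linarith
      calc T (x / 2 ^ (n + 1 + 1)) = T (x / 2 ^ (n + 1) / 2) := by rw [pow_succ _ (n + 1), div_div]
        _ ≤ 2 ^ β * T (x / 2 ^ (n + 1)) := hstep _ hx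
        _ ≤ 2 ^ β * (((2 : ℝ) ^ β) ^ (n + 1) * T x) := by
          gcongr
          exact ih x h1
        _ = ((2 : ℝ) ^ β) ^ (n + 1 + 1) * T x := by ring
  refine ⟨max x₁ 1, zero_lt_one.trans_le (le_max_right _ _), fun x y hy hxy => ?_⟩
  -- With `2 ^ n ≤ y < 2 ^ (n + 1)`, rounding up to `2 ^ (n + 1) ≤ 2 * y` is the source of the
  -- factor `2`.
  obtain ⟨n, hn1, hn2⟩ := exists_nat_pow_near hy one_lt_two
  have hy0 : 0 < y := zero_lt_one.trans_le hy
  have hx0 : 0 ≤ x := by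
    by_contra hneg
    have := div_neg_of_neg_of_pos (not_le.1 hneg) hy0
    linarith [le_max_right x₁ 1]
  calc T (x / y) ≤ T (x / 2 ^ (n + 1)) := hanti (by gcongr)
    _ ≤ ((2 : ℝ) ^ β) ^ (n + 1) * T x := hiter n x (hxy.trans (by gcongr))
    _ = ((2 : ℝ) ^ (n + 1)) ^ β * T x := by
      rw [← Real.rpow_natCast, ← Real.rpow_mul two_pos.le, mul_comm β,
        Real.rpow_mul two_pos.le, Real.rpow_natCast]
    _ ≤ (2 * y) ^ β * T x := by
      have : (2 : ℝ) ^ (n + 1) ≤ 2 * y := by rw [pow_succ]; linarith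
      gcongr
      exact (hT x).le

/-- The domination coming from the cutoff function in place of a Potter bound. -/
theorem CutoffBound.exists_bound {T L g : ℝ → ℝ} {α : ℝ} (hbd : CutoffBound L g)
    (hL : ∀ x, 0 < x → 0 < L x) (hanti : Antitone T) (hT : ∀ x, 0 < T x)
    (hTL : Tendsto (fun x => T x / (x ^ (-α) * L x)) atTop (𝓝 1))
    (hg0 : Tendsto g atTop (𝓝 0)) :
    ∃ C : ℝ, ∀ᶠ x in atTop, ∀ y, 0 < y → y ≤ x * g x → T (x / y) ≤ (1 + C * y ^ α) * T x := by
  obtain ⟨C, hC1, -⟩ := EReal.lt_iff_exists_real_btwn.1 hbd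
  obtain ⟨z₁, hz₁⟩ := eventually_atTop.1 ((hTL.eventually (gt_mem_nhds one_lt_two)).and
    ((hTL.eventually (lt_mem_nhds one_half_lt_one)).and (eventually_gt_atTop 0)))
  have hup : ∀ z, z₁ ≤ z → T z ≤ 2 * (z ^ (-α) * L z) := fun z hz => by
    obtain ⟨h1, -, h3⟩ := hz₁ z hz
    exact ((div_lt_iff₀ (mul_pos (Real.rpow_pos_of_pos h3 _) (hL z h3))).1 h1).le
  have hlow : ∀ z, z₁ ≤ z → 1 / 2 * (z ^ (-α) * L z) ≤ T z := fun z hz => by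
    obtain ⟨-, h2, h3⟩ := hz₁ z hz
    exact ((lt_div_iff₀ (mul_pos (Real.rpow_pos_of_pos h3 _) (hL z h3))).1 h2).le
  have hginv : ∀ᶠ x in atTop, g x < (max z₁ 1)⁻¹ :=
    hg0.eventually (gt_mem_nhds (inv_pos.2 (zero_lt_one.trans_le (le_max_right _ _))))
  -- The `4` combines the bounds `2` and `1 / 2` on `T x / (x ^ (-α) * L x)`; the summand `1` in the
  -- conclusion covers `y ≤ 1` by monotonicity.
  refine ⟨4 * max C 0, ?_⟩
  filter_upwards [eventually_lt_of_limsup_lt hC1, hginv, eventually_ge_atTop z₁,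
    eventually_gt_atTop 0] with x hCx hgx hx1 hx0 y hy0 hyx
  have hC0 : 0 ≤ 4 * max C 0 := by positivity
  have hyα : 0 ≤ y ^ α := Real.rpow_nonneg hy0.le _
  rcases le_total y 1 with hy1 | hy1
  · have h1 : T (x / y) ≤ T x := hanti (by
      rw [le_div_iff₀ hy0]
      nlinarith)
    nlinarith [mul_nonneg (mul_nonneg hC0 hyα) (hT x).le]
  · have hxy0 : 0 < x / y := div_pos hx0 hy0
    -- From `y ≤ x * g x` follows `x / y ≥ 1 / g x`, which is large because `g` tends to `0`.
    have hxy : z₁ ≤ x / y := by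
      have h1 : (max z₁ 1) * g x ≤ 1 := by
        have h2 := mul_le_mul_of_nonneg_left hgx.le
          (zero_le_one.trans (le_max_right z₁ 1))
        rwa [mul_inv_cancel₀ (zero_lt_one.trans_le (le_max_right z₁ 1)).ne'] at h2
      have h2 : max z₁ 1 ≤ x / y := by
        rw [le_div_iff₀ hy0]
        calc max z₁ 1 * y ≤ max z₁ 1 * (x * g x) := by gcongr
          _ = x * (max z₁ 1 * g x) := by ring
          _ ≤ x * 1 := by gcongr
          _ = x := mul_one x
      exact (le_max_left _ _).trans h2
    have hLle : L (x / y) ≤ max C 0 * L x := by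
      have h1 : ((L (x / y) / L x : ℝ) : EReal) ≤ C :=
        (le_iSup₂ (f := fun (y : ℝ) (_ : y ∈ Icc (1 : ℝ) (x * g x)) =>
          ((L (x / y) / L x : ℝ) : EReal)) y ⟨hy1, hyx⟩).trans hCx.le
      rw [EReal.coe_le_coe_iff, div_le_iff₀ (hL x hx0)] at h1
      exact h1.trans (mul_le_mul_of_nonneg_right (le_max_left _ _) (hL x hx0).le)
    have hpow : (x / y) ^ (-α) = x ^ (-α) * y ^ α := by
      rw [Real.div_rpow hx0.le hy0.le, Real.rpow_neg hy0.le, div_inv_eq_mul]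
    have hxα : 0 < x ^ (-α) := Real.rpow_pos_of_pos hx0 _
    calc T (x / y) ≤ 2 * ((x / y) ^ (-α) * L (x / y)) := hup _ hxy
      _ ≤ 2 * ((x / y) ^ (-α) * (max C 0 * L x)) := by gcongr
      _ = 4 * max C 0 * y ^ α * (1 / 2 * (x ^ (-α) * L x)) := by rw [hpow]; ring
      _ ≤ 4 * max C 0 * y ^ α * T x := by
        gcongr
        exact hlow x hx1
      _ ≤ (1 + 4 * max C 0 * y ^ α) * T x := by nlinarith [hT x]

end TailAsymptotics

/-! ### Dominated convergence over the law of `η`. -/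

section Product

variable {Ω : Type*} [MeasurableSpace Ω] {μ : Measure Ω} [IsProbabilityMeasure μ] {ξ η : Ω → ℝ}

theorem measurable_condDistrib_Ioi {c : ℝ → ℝ} (hc : Measurable c) :
    Measurable fun y => (condDistrib ξ η μ y).real (Ioi (c y)) := by
  have hA : MeasurableSet {q : ℝ × ℝ | c q.1 < q.2} :=
    measurableSet_lt (hc.comp measurable_fst) measurable_snd
  exact (Kernel.measurable_kernel_prodMk_left (κ := condDistrib ξ η μ) hA).ennreal_toReal

theorem measureReal_eq_integral_condDistrib_Ioi (hξ : Measurable ξ) (hη : Measurable η)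
    {c : ℝ → ℝ} (hc : Measurable c) {B : Set ℝ} (hB : MeasurableSet B) :
    μ.real {ω | η ω ∈ B ∧ c (η ω) < ξ ω} =
      ∫ y, B.indicator (fun y => (condDistrib ξ η μ y).real (Ioi (c y))) y ∂(μ.map η) := by
  have hprob := Measure.isProbabilityMeasure_map hη.aemeasurable (μ := μ)
  have hA : MeasurableSet {q : ℝ × ℝ | q.1 ∈ B ∧ c q.1 < q.2} :=
    (measurable_fst hB).inter (measurableSet_lt (hc.comp measurable_fst) measurable_snd)
  have h1 : μ {ω | η ω ∈ B ∧ c (η ω) < ξ ω} =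
      ∫⁻ y, condDistrib ξ η μ y (Prod.mk y ⁻¹' {q : ℝ × ℝ | q.1 ∈ B ∧ c q.1 < q.2}) ∂(μ.map η) := by
    rw [← Measure.compProd_apply hA, compProd_map_condDistrib hξ.aemeasurable,
      Measure.map_apply (hη.prodMk hξ) hA]
    rfl
  rw [measureReal_def, h1, ← integral_toReal
    (Kernel.measurable_kernel_prodMk_left hA).aemeasurable
    (Eventually.of_forall fun y => measure_lt_top _ _)]
  congr 1
  ext y
  by_cases hy : y ∈ B
  · simp only [hy, indicator_of_mem, measureReal_def]
    congr 2
    ext z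
    simp [hy]
  · simp [hy]

variable {s : ℝ → ℝ}

/-- The kernel tail at the fixed level `x₀` is at most `1` and at least `T(x₀) s(y) / 2`, so `s` is
bounded almost everywhere. -/
theorem IsCDWith.integrable_map (hCD : IsCDWith μ ξ η s) (hξ : Measurable ξ) (hη : Measurable η)
    (hηpos : ∀ᵐ ω ∂μ, 0 < η ω) (hs : ContinuousOn s (Ioi 0)) (hT : ∀ x, 0 < tail μ ξ x) :
    Integrable s (μ.map η) := by
  have hprob := Measure.isProbabilityMeasure_map hη.aemeasurable (μ := μ)
  obtain ⟨x₀, hx₀⟩ := hCD.eventually_condDistrib_Ioi_mem_Icc hξ hη hηpos hs hT one_half_pos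
  have hpos : ∀ᵐ y ∂(μ.map η), y ∈ Ioi (0 : ℝ) := hx₀.mono fun y hy => hy.1
  have hmeas : AEStronglyMeasurable s (μ.map η) := by
    rw [← Measure.restrict_eq_self_of_ae_mem hpos]
    exact hs.aestronglyMeasurable measurableSet_Ioi
  refine Integrable.of_bound hmeas (2 / tail μ ξ x₀) ?_
  filter_upwards [hx₀] with y hy
  have hsy := hCD.1 y hy.1
  have h1 := (hy.2 x₀ le_rfl).1
  have h2 : (condDistrib ξ η μ y).real (Ioi x₀) ≤ 1 := measureReal_le_one
  rw [Real.norm_of_nonneg hsy.le, le_div_iff₀ (hT x₀)]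
  linarith

theorem IsCDWith.ae_tendsto_condDistrib_Ioi (hCD : IsCDWith μ ξ η s) (hξ : Measurable ξ)
    (hη : Measurable η) (hηpos : ∀ᵐ ω ∂μ, 0 < η ω) (hs : ContinuousOn s (Ioi 0))
    (hT : ∀ x, 0 < tail μ ξ x) :
    ∀ᵐ y ∂(μ.map η), Tendsto (fun z => (condDistrib ξ η μ y).real (Ioi z) / tail μ ξ z) atTop
      (𝓝 (s y)) := by
  choose x₀ hx₀ using fun n : ℕ => hCD.eventually_condDistrib_Ioi_mem_Icc hξ hη hηpos hs hT
    (Nat.one_div_pos_of_nat (α := ℝ) (n := n))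
  filter_upwards [ae_all_iff.2 hx₀] with y hy
  have hsy := hCD.1 y (hy 0).1
  rw [Metric.tendsto_atTop]
  intro δ hδ
  obtain ⟨n, hn⟩ := exists_nat_one_div_lt (div_pos hδ hsy)
  refine ⟨x₀ n, fun z hz => ?_⟩
  obtain ⟨h1, h2⟩ := (hy n).2 z hz
  have hTz := hT z
  have hn' := (lt_div_iff₀ hsy).1 hn
  have h3 : (1 - 1 / ((n : ℝ) + 1)) * s y ≤
      (condDistrib ξ η μ y).real (Ioi z) / tail μ ξ z := by
    rw [le_div_iff₀ hTz]
    linarith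
  have h4 : (condDistrib ξ η μ y).real (Ioi z) / tail μ ξ z ≤
      (1 + 1 / ((n : ℝ) + 1)) * s y := by
    rw [div_le_iff₀ hTz]
    linarith
  rw [Real.dist_eq, abs_lt]
  constructor <;> linarith

/-- Dominated convergence for the joint probabilities `P(η ∈ B, ξ > c(x, η))`. -/
theorem IsCDWith.tendsto_measureReal_div (hCD : IsCDWith μ ξ η s) (hξ : Measurable ξ)
    (hη : Measurable η) (hηpos : ∀ᵐ ω ∂μ, 0 < η ω) (hs : ContinuousOn s (Ioi 0))
    (hT : ∀ x, 0 < tail μ ξ x) {c : ℝ → ℝ → ℝ} {B : ℝ → Set ℝ} {w h : ℝ → ℝ}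
    (hc : ∀ x, Measurable (c x)) (hB : ∀ x, MeasurableSet (B x))
    (hc_top : ∀ M, ∀ᶠ x in atTop, ∀ y, 0 < y → M ≤ c x y)
    (hB_top : ∀ y, 0 < y → ∀ᶠ x in atTop, y ∈ B x)
    (hw : ∀ y, 0 < y → Tendsto (fun x => tail μ ξ (c x y) / tail μ ξ x) atTop (𝓝 (w y)))
    (hle : ∀ᶠ x in atTop, ∀ y, 0 < y → y ∈ B x → tail μ ξ (c x y) ≤ h y * tail μ ξ x)
    (hint : Integrable (fun y => h y * s y) (μ.map η)) :
    Tendsto (fun x => μ.real {ω | η ω ∈ B x ∧ c x (η ω) < ξ ω} / tail μ ξ x) atTop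
      (𝓝 (∫ y, w y * s y ∂(μ.map η))) := by
  -- For the majorant the crude choice `ε = 1` suffices, whence the factor `2`; the pointwise limit
  -- uses every `ε`.
  obtain ⟨x₀, hx₀⟩ := hCD.eventually_condDistrib_Ioi_mem_Icc hξ hη hηpos hs hT one_pos
  simp only [measureReal_eq_integral_condDistrib_Ioi hξ hη (hc _) (hB _), ← integral_div]
  refine tendsto_integral_filter_of_dominated_convergence (fun y => 2 * |h y * s y|)
    (Eventually.of_forall fun x =>
      (((measurable_condDistrib_Ioi (hc x)).indicator (hB x)).div_const _).aestronglyMeasurable)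
    ?_ (hint.abs.const_mul 2) ?_
  · filter_upwards [hc_top x₀, hle] with x hx1 hx2
    filter_upwards [hx₀] with y hy
    by_cases hyB : y ∈ B x
    · rw [indicator_of_mem hyB, Real.norm_of_nonneg (div_nonneg measureReal_nonneg (hT x).le),
        div_le_iff₀ (hT x)]
      have hsy := hCD.1 y hy.1
      calc (condDistrib ξ η μ y).real (Ioi (c x y))
          ≤ (1 + 1) * (tail μ ξ (c x y) * s y) := (hy.2 _ (hx1 y hy.1)).2
        _ ≤ (1 + 1) * (h y * tail μ ξ x * s y) := by
          gcongr
          exact hx2 y hy.1 hyB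
        _ = 2 * (h y * s y) * tail μ ξ x := by ring
        _ ≤ 2 * |h y * s y| * tail μ ξ x := by
          have := (hT x).le
          gcongr
          exact le_abs_self _
    · rw [indicator_of_notMem hyB, zero_div, norm_zero]
      positivity
  · filter_upwards [hCD.ae_tendsto_condDistrib_Ioi hξ hη hηpos hs hT, hx₀] with y hy hy0
    have htop : Tendsto (fun x => c x y) atTop atTop :=
      tendsto_atTop.2 fun M => (hc_top M).mono fun x hx => hx y hy0.1
    have h1 := (hw y hy0.1).mul (hy.comp htop)
    refine h1.congr' ?_
    filter_upwards [hB_top y hy0.1] with x hx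
    have := (hT (c x y)).ne'
    have := (hT x).ne'
    rw [indicator_of_mem hx, Function.comp]
    field_simp

/-- With a constant threshold and no truncation the quotient is identically `1`, while its limit is
the integral of `s`. -/
theorem IsCDWith.integral_map_eq_one (hCD : IsCDWith μ ξ η s) (hξ : Measurable ξ)
    (hη : Measurable η) (hηpos : ∀ᵐ ω ∂μ, 0 < η ω) (hs : ContinuousOn s (Ioi 0))
    (hT : ∀ x, 0 < tail μ ξ x) : ∫ y, s y ∂(μ.map η) = 1 := by
  have h := hCD.tendsto_measureReal_div hξ hη hηpos hs hT (c := fun x _ => x)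
    (B := fun _ => univ) (w := fun _ => 1) (h := fun _ => 1) (fun x => measurable_const)
    (fun _ => MeasurableSet.univ) (fun M => (eventually_ge_atTop M).mono fun x hx y _ => hx)
    (fun y _ => by simp)
    (fun y _ => tendsto_const_nhds.congr fun x => (div_self (hT x).ne').symm)
    (by simp)
    (by simpa using hCD.integrable_map hξ hη hηpos hs hT)
  simp only [one_mul] at h
  refine tendsto_nhds_unique h (tendsto_const_nhds.congr fun x => ?_)
  simp only [mem_univ, true_and]
  exact (div_self (hT x).ne').symm

theorem IsCDWith.tendsto_tail_sub_div (hCD : IsCDWith μ ξ η s) (hξ : Measurable ξ)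
    (hη : Measurable η) (hηpos : ∀ᵐ ω ∂μ, 0 < η ω) (hs : ContinuousOn s (Ioi 0))
    (hT : ∀ x, 0 < tail μ ξ x) (hlong : IsLongTailed (tail μ ξ)) :
    Tendsto (fun x => tail μ (fun ω => ξ ω - η ω) x / tail μ ξ x) atTop (𝓝 1) := by
  have h := hCD.tendsto_measureReal_div hξ hη hηpos hs hT (c := fun x y => x + y)
    (B := fun _ => univ) (w := fun _ => 1) (h := fun _ => 1) (fun x => measurable_const_add x)
    (fun _ => MeasurableSet.univ)
    (fun M => (eventually_ge_atTop M).mono fun x hx y hy => by linarith)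
    (fun y _ => by simp)
    (fun y hy => hlong.tendsto_add hy)
    (Eventually.of_forall fun x y hy _ => by
      rw [one_mul]
      exact tail_antitone ξ (by linarith))
    (by simpa using hCD.integrable_map hξ hη hηpos hs hT)
  simp only [one_mul, hCD.integral_map_eq_one hξ hη hηpos hs hT, mem_univ, true_and] at h
  refine h.congr fun x => ?_
  congr 2
  ext ω
  change x + η ω < ξ ω ↔ x < ξ ω - η ω
  exact lt_sub_iff_add_lt.symm

/-- The tail of `(ξ - η) η` when the large values of `η` are negligible beyond `b`. -/
theorem IsCDWith.tendsto_tail_mul_div (hCD : IsCDWith μ ξ η s) (hξ : Measurable ξ)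
    (hη : Measurable η) (hηpos : ∀ᵐ ω ∂μ, 0 < η ω) (hs : ContinuousOn s (Ioi 0))
    (hT : ∀ x, 0 < tail μ ξ x) (hlong : IsLongTailed (tail μ ξ)) {α : ℝ}
    (hRV : IsRegVaryingTail (tail μ ξ) α) {b h : ℝ → ℝ} (hb : Tendsto b atTop atTop)
    (hG : (fun x => tail μ η (b x)) =o[atTop] tail μ ξ)
    (hle : ∀ᶠ x in atTop, ∀ y, 0 < y → y ≤ b x → tail μ ξ (x / y) ≤ h y * tail μ ξ x)
    (hint : Integrable (fun y => h y * s y) (μ.map η)) :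
    Tendsto (fun x => tail μ (fun ω => (ξ ω - η ω) * η ω) x / tail μ ξ x) atTop
      (𝓝 (∫ y, y ^ α * s y ∂(μ.map η))) := by
  have hmain := hCD.tendsto_measureReal_div hξ hη hηpos hs hT (c := fun x y => y + x / y)
    (B := fun x => Iic (b x)) (w := fun y => y ^ α) (h := h)
    (fun x => measurable_id.add (measurable_const.div measurable_id))
    (fun _ => measurableSet_Iic)
    -- Uniformity in `y`: if `y < M` then `x / y ≥ M` once `x ≥ M ^ 2`; otherwise the summand `y`
    -- already reaches `M`.
    (fun M => by
      filter_upwards [eventually_ge_atTop (M ^ 2), eventually_ge_atTop 0] with x hx hx0 y hy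
      have hxy : 0 ≤ x / y := div_nonneg hx0 hy.le
      rcases le_total M y with hM | hM
      · linarith
      · have : M ≤ x / y := by
          rw [le_div_iff₀ hy]
          nlinarith
        linarith)
    (fun y _ => hb.eventually (eventually_ge_atTop y))
    -- Long-tailedness at `x / y` removes the shift by `y`; regular variation gives the limit `y ^
    -- α`.
    (fun y hy => by
      have h1 := ((hlong.tendsto_add hy).comp (tendsto_id.atTop_div_const hy)).mul
        (hRV.tendsto_div hy)
      rw [one_mul] at h1
      refine h1.congr fun x => ?_
      have := (hT (x / y)).ne'
      have := (hT x).ne'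
      simp only [Function.comp, id, add_comm y]
      field_simp)
    (by
      filter_upwards [hle] with x hx y hy hyb
      exact (tail_antitone ξ (by linarith)).trans (hx y hy hyb))
    hint
  have hrem : Tendsto (fun x => tail μ η (b x) / tail μ ξ x) atTop (𝓝 0) := hG.tendsto_div_nhds_zero
  have hiff : ∀ᵐ ω ∂μ, ∀ x, (x < (ξ ω - η ω) * η ω ↔ η ω + x / η ω < ξ ω) := by
    filter_upwards [hηpos] with ω hω x
    rw [← div_lt_iff₀ hω, lt_sub_iff_add_lt, add_comm]
  have hlow : ∀ x, μ.real {ω | η ω ∈ Iic (b x) ∧ η ω + x / η ω < ξ ω} ≤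
      tail μ (fun ω => (ξ ω - η ω) * η ω) x := by
    intro x
    refine ENNReal.toReal_mono (measure_ne_top _ _) (measure_mono_ae ?_)
    filter_upwards [hiff] with ω hω h1
    exact (hω x).2 h1.2
  have hup : ∀ x, tail μ (fun ω => (ξ ω - η ω) * η ω) x ≤
      μ.real {ω | η ω ∈ Iic (b x) ∧ η ω + x / η ω < ξ ω} + tail μ η (b x) := by
    intro x
    refine le_trans (ENNReal.toReal_mono (measure_ne_top _ _) (measure_mono_ae ?_))
      (measureReal_union_le _ _)
    filter_upwards [hiff] with ω hω h1
    rcases le_or_gt (η ω) (b x) with h2 | h2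
    · exact Or.inl ⟨h2, (hω x).1 h1⟩
    · exact Or.inr h2
  have hsum := hmain.add hrem
  rw [add_zero] at hsum
  refine tendsto_of_tendsto_of_tendsto_of_le_of_le hmain hsum (fun x => ?_) (fun x => ?_)
  · exact div_le_div_of_nonneg_right (hlow x) (hT x).le
  · change _ ≤ _ / _ + _ / _
    rw [← add_div]
    exact div_le_div_of_nonneg_right (hup x) (hT x).le

end Product

/-! ### Truncation levels and integrable majorants in the two cases. -/

section Domination

variable {Ω : Type*} [MeasurableSpace Ω] {μ : Measure Ω} [IsProbabilityMeasure μ] {ξ η : Ω → ℝ}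
  {s : ℝ → ℝ}

theorem integrable_rpow_mul_of_le {ν : Measure ℝ} (hpos : ∀ᵐ y ∂ν, 0 < y) {α β : ℝ} (hα : 0 ≤ α)
    (hαβ : α ≤ β) (hs : Integrable s ν) (hβ : Integrable (fun y => y ^ β * s y) ν) :
    Integrable (fun y => y ^ α * s y) ν := by
  refine (hs.abs.add hβ.abs).mono'
    ((measurable_id.pow_const α).aestronglyMeasurable.mul hs.aestronglyMeasurable) ?_
  filter_upwards [hpos] with y hy
  have h1 : y ^ α ≤ 1 + y ^ β := by
    have h0 := (Real.rpow_pos_of_pos hy β).le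
    rcases le_total y 1 with h | h
    · linarith [Real.rpow_le_one hy.le h hα]
    · linarith [Real.rpow_le_rpow_of_exponent_le h hαβ]
  rw [Real.norm_eq_abs, abs_mul, abs_of_pos (Real.rpow_pos_of_pos hy α)]
  calc y ^ α * |s y| ≤ (1 + y ^ β) * |s y| := by gcongr
    _ = |s y| + |y ^ β * s y| := by
      rw [abs_mul, abs_of_pos (Real.rpow_pos_of_pos hy β)]
      ring

theorem exists_domination_of_moment {F : ℝ → ℝ} (hη : Measurable η)
    (hηpos : ∀ᵐ ω ∂μ, 0 < η ω) (hT : ∀ x, 0 < tail μ ξ x) {α ε : ℝ} (hα : 0 ≤ α) (hε : 0 < ε)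
    (hRV : IsRegVaryingTail (tail μ ξ) α) (hF : F =O[atTop] tail μ ξ) (hG : tail μ η =o[atTop] F)
    (hs : Integrable s (μ.map η)) (hmom : Integrable (fun y => y ^ (α + ε) * s y) (μ.map η)) :
    ∃ b h : ℝ → ℝ, Tendsto b atTop atTop ∧ (fun x => tail μ η (b x)) =o[atTop] tail μ ξ ∧
      (∀ᶠ x in atTop, ∀ y, 0 < y → y ≤ b x → tail μ ξ (x / y) ≤ h y * tail μ ξ x) ∧
      Integrable (fun y => h y * s y) (μ.map η) := by
  have hpos : ∀ᵐ y ∂(μ.map η), 0 < y := (ae_map_iff hη.aemeasurable measurableSet_Ioi).2 hηpos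
  obtain ⟨x₁, hx₁, hpotter⟩ := hRV.potter_bound (tail_antitone ξ) hT
    (β := α + ε) (by linarith) (by linarith)
  have hb : Tendsto (fun x : ℝ => x / x₁) atTop atTop := tendsto_id.atTop_div_const hx₁
  -- The cut `y ≤ x / x₁` is exactly the Potter range `x₁ ≤ x / y`; rescaling by `x₁` changes `T`
  -- only by a bounded factor, so the remainder is still negligible.
  refine ⟨fun x => x / x₁, fun y => 1 + (2 * y) ^ (α + ε), hb, ?_, ?_, ?_⟩
  · have h1 := (hG.trans_isBigO hF).comp_tendsto hb
    refine h1.trans_isBigO ?_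
    exact Asymptotics.isBigO_of_div_tendsto_nhds (Eventually.of_forall fun x hx =>
      absurd hx (hT x).ne') _ (hRV.tendsto_div hx₁)
  · filter_upwards [eventually_gt_atTop 0] with x hx y hy hyx
    have h0 : 0 ≤ (2 * y) ^ (α + ε) := by positivity
    have hTx := (hT x).le
    rcases le_total y 1 with h | h
    · have h1 : tail μ ξ (x / y) ≤ tail μ ξ x := tail_antitone ξ (by
        rw [le_div_iff₀ hy]
        nlinarith)
      nlinarith [mul_nonneg h0 hTx]
    · have h1 := hpotter x y h (by
        rw [le_div_iff₀ hx₁] at hyx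
        rw [le_div_iff₀ hy]
        linarith)
      linarith
  · refine (hs.add (hmom.const_mul ((2 : ℝ) ^ (α + ε)))).congr ?_
    filter_upwards [hpos] with y hy
    rw [Pi.add_apply, Real.mul_rpow two_pos.le hy.le]
    ring

theorem exists_domination_of_cutoff {F L g : ℝ → ℝ} {α : ℝ} (hT : ∀ x, 0 < tail μ ξ x)
    (hFT : Tendsto (fun x => F x / tail μ ξ x) atTop (𝓝 1)) (hF : F =O[atTop] tail μ ξ)
    (hL : IsSlowlyVarying L) (hFL : Tendsto (fun x => F x / (x ^ (-α) * L x)) atTop (𝓝 1))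
    (hg : IsCutoff (tail μ η) F g) (hbd : CutoffBound L g)
    (hs : Integrable s (μ.map η)) (hmom : Integrable (fun y => y ^ α * s y) (μ.map η)) :
    ∃ b h : ℝ → ℝ, Tendsto b atTop atTop ∧ (fun x => tail μ η (b x)) =o[atTop] tail μ ξ ∧
      (∀ᶠ x in atTop, ∀ y, 0 < y → y ≤ b x → tail μ ξ (x / y) ≤ h y * tail μ ξ x) ∧
      Integrable (fun y => h y * s y) (μ.map η) := by
  obtain ⟨-, -, hg0, -, hgtop, hgG⟩ := hg
  have hTL : Tendsto (fun x => tail μ ξ x / (x ^ (-α) * L x)) atTop (𝓝 1) := by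
    have h1 := (hFT.inv₀ one_ne_zero).mul hFL
    rw [inv_one, one_mul] at h1
    refine h1.congr' ?_
    filter_upwards [hFT.eventually (lt_mem_nhds (show (0 : ℝ) < 1 by norm_num)),
      eventually_gt_atTop 0] with x hx hx0
    have h2 : F x ≠ 0 := fun h => by simp [h] at hx
    have h3 := (Real.rpow_pos_of_pos hx0 (-α)).ne'
    have h4 := (hL.1 x hx0).ne'
    have h5 := (hT x).ne'
    field_simp
  obtain ⟨C, hC⟩ := hbd.exists_bound hL.1 (tail_antitone ξ) hT hTL hg0
  refine ⟨fun x => x * g x, fun y => 1 + C * y ^ α, hgtop, hgG.trans_isBigO hF, hC, ?_⟩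
  refine (hs.add (hmom.const_mul C)).congr (Eventually.of_forall fun y => ?_)
  simp only [Pi.add_apply]
  ring

end Domination

/-! ### The product asymptotics. -/

theorem corollary2p4 {Ω : Type*} [MeasurableSpace Ω] (μ : Measure Ω) [IsProbabilityMeasure μ]
    (ξ η : Ω → ℝ) (hξ : Measurable ξ) (hη : Measurable η)
    (hξpos : ∀ᵐ ω ∂μ, 0 < ξ ω) (hηpos : ∀ᵐ ω ∂μ, 0 < η ω)
    (s₀ : ℝ → ℝ) (hs₀ : ContinuousOn s₀ (Ioi 0)) (hCD : IsCDWith μ ξ η s₀)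
    (hU : IsLongTailed (tail μ ξ))
    (X Y : Ω → ℝ) (hX : X = fun ω => ξ ω - η ω) (hY : Y = η)
    (s : ℝ → ℝ) (hs : s = fun y => s₀ y / ∫ ω, s₀ (η ω) ∂μ)
    (α : ℝ) (hα : 0 ≤ α) (hF : IsRegVaryingTail (tail μ X) α)
    (hG : tail μ Y =o[atTop] tail μ X)
    (hmom :
      (∃ ε : ℝ, 0 < ε ∧ Integrable (fun ω => Y ω ^ (α + ε) * s (Y ω)) μ) ∨
      (∃ L g : ℝ → ℝ, IsSlowlyVarying L ∧
        Tendsto (fun x => tail μ X x / (x ^ (-α) * L x)) atTop (𝓝 1) ∧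
        IsCutoff (tail μ Y) (tail μ X) g ∧ CutoffBound L g ∧
        Integrable (fun ω => Y ω ^ α * s (Y ω)) μ)) :
    Integrable (fun ω => s₀ (η ω)) μ ∧ 0 < ∫ ω, s₀ (η ω) ∂μ ∧
      Integrable (fun ω => Y ω ^ α * s (Y ω)) μ ∧
      Tendsto (fun x => tail μ (fun ω => X ω * Y ω) x /
        ((∫ ω, Y ω ^ α * s (Y ω) ∂μ) * tail μ X x)) atTop (𝓝 1) := by

  subst hX hY
  have hT : ∀ x, 0 < tail μ ξ x := hU.pos (tail_antitone ξ) (tail_nonneg ξ)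
  have hint₀ := hCD.integrable_map hξ hη hηpos hs₀ hT
  have hE : ∫ ω, s₀ (Y ω) ∂μ = 1 := by
    rw [← integral_map hη.aemeasurable hint₀.aestronglyMeasurable]
    exact hCD.integral_map_eq_one hξ hη hηpos hs₀ hT
  -- The normalising constant is `1`, so `s` and `s₀` coincide.
  obtain rfl : s = s₀ := by
    rw [hs, hE]
    simp
  have hpos : ∀ᵐ y ∂(μ.map Y), 0 < y := (ae_map_iff hη.aemeasurable measurableSet_Ioi).2 hηpos
  have hmeas : ∀ β : ℝ, AEStronglyMeasurable (fun y => y ^ β * s y) (μ.map Y) := fun β =>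
    (measurable_id.pow_const β).aestronglyMeasurable.mul hint₀.aestronglyMeasurable
  have hmap : ∀ β : ℝ, Integrable (fun ω => Y ω ^ β * s (Y ω)) μ ↔
      Integrable (fun y => y ^ β * s y) (μ.map Y) := fun β =>
    (integrable_map_measure (hmeas β) hη.aemeasurable).symm
  have hFT := hCD.tendsto_tail_sub_div hξ hη hηpos hs₀ hT hU
  have hRV := hF.of_tendsto_div hT hFT
  have hFO : tail μ (fun ω => ξ ω - Y ω) =O[atTop] tail μ ξ :=
    Asymptotics.isBigO_of_div_tendsto_nhds (Eventually.of_forall fun x hx =>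
      absurd hx (hT x).ne') _ hFT
  have hdom : Integrable (fun y => y ^ α * s y) (μ.map Y) ∧
      ∃ b h : ℝ → ℝ, Tendsto b atTop atTop ∧ (fun x => tail μ Y (b x)) =o[atTop] tail μ ξ ∧
      (∀ᶠ x in atTop, ∀ y, 0 < y → y ≤ b x → tail μ ξ (x / y) ≤ h y * tail μ ξ x) ∧
      Integrable (fun y => h y * s y) (μ.map Y) := by
    rcases hmom with ⟨ε, hε, hm⟩ | ⟨L, g, hL, hFL, hg, hbd, hm⟩
    · rw [hmap] at hm
      exact ⟨integrable_rpow_mul_of_le hpos hα (by linarith) hint₀ hm,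
        exists_domination_of_moment hη hηpos hT hα hε hRV hFO hG hint₀ hm⟩
    · rw [hmap] at hm
      exact ⟨hm, exists_domination_of_cutoff hT hFT hFO hL hFL hg hbd hint₀ hm⟩
  obtain ⟨hintα, b, h, hb, hGb, hle, hint⟩ := hdom
  have hlim := hCD.tendsto_tail_mul_div hξ hη hηpos hs₀ hT hU hRV hb hGb hle hint
  have hIeq : ∫ ω, Y ω ^ α * s (Y ω) ∂μ = ∫ y, y ^ α * s y ∂(μ.map Y) :=
    (integral_map hη.aemeasurable (hmeas α)).symm
  have hIpos : 0 < ∫ y, y ^ α * s y ∂(μ.map Y) := by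
    have hprob := Measure.isProbabilityMeasure_map hη.aemeasurable (μ := μ)
    have hposα : ∀ᵐ y ∂(μ.map Y), 0 < y ^ α * s y := by
      filter_upwards [hpos] with y hy
      exact mul_pos (Real.rpow_pos_of_pos hy α) (hCD.1 y hy)
    have hnonneg : 0 ≤ᵐ[μ.map Y] fun y => y ^ α * s y := hposα.mono fun y hy => hy.le
    refine (integral_nonneg_of_ae hnonneg).lt_of_ne' fun h0 => ?_
    obtain ⟨y, h1, h2⟩ :=
      (hposα.and ((integral_eq_zero_iff_of_nonneg_ae hnonneg hintα).1 h0)).exists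
    exact h1.ne' h2
  refine ⟨(integrable_map_measure hint₀.aestronglyMeasurable hη.aemeasurable).1 hint₀,
    by rw [hE]; exact one_pos, (hmap α).2 hintα, ?_⟩
  rw [hIeq]
  -- Both tails were compared with `T`, which cancels; positivity of the integral is needed to
  -- normalise the limit to `1`.
  have hquot := (hlim.div hFT one_ne_zero).div_const (∫ y, y ^ α * s y ∂(μ.map Y))
  rw [div_one, div_self hIpos.ne'] at hquot
  refine hquot.congr fun x => ?_
  simp only [Pi.div_apply]
  rw [div_div_div_cancel_right₀ (hT x).ne', div_div, mul_comm]
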